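/- For a nonempty set $C\subset\mathbb{R}^n$ and a linear subspace $H\subset\mathbb{R}^n$, let $R_H$ be the orthogonal reflection with respect to $H$ (that is, $R_Hx=2(x|H)-x$, where $x|H$ is the orthogonal projection of $x$ onto $H$), and define the fiber symmetral of $C$ by $$F_H C:=\bigcup_{x\in H}\Big[\tfrac12\big(C\cap(H^\perp+x)\big)+\tfrac12\big(R_HC\cap(H^\perp+x)\big)\Big],$$ where $+$ between sets is the Minkowski sum. **Theorem.** Let $K\subset\mathbb{R}^n$ be a nonempty compact set such that $\partial\,\mathrm{conv}(K)\subset K$, where $\mathrm{conv}$ is the convex hull and $\partial$ the topological boundary in $\mathbb{R}^n$. Let $\mathcal F=\{Q_1,\dots,Q_s\}$ be a finite family of linear subspaces of $\mathbb{R}^n$ with $1\le\dim Q_i\le n-2$, and let $\{H_m\}_{m\ge1}$ be a sequence with $H_m\in\mathcal F$ for every $m$. Then the sequence $$K_m:=F_{H_m}\cdots F_{H_1}K$$ converges in the Hausdorff metric to a nonempty compact convex set $L$, and the sequence $F_{H_m}\cdots F_{H_1}\mathrm{conv}(K)$ converges to the same set $L$. Moreover $R_{Q}L=L$ for every $Q\in\mathcal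 F$ which appears infinitely often in the sequence $\{H_m\}$. -/

import Mathlib

open scoped Pointwise Topology

namespace FiberSymm

/-- Euclidean `n`-space. -/
abbrev E (n : ℕ) : Type := EuclideanSpace ℝ (Fin n)

/-- The image `R_H C` of `C` under the orthogonal reflection `x ↦ 2 (x|H) - x` fixing the linear
subspace `H`. -/
noncomputable def reflectSet {n : ℕ} (H : Submodule ℝ (E n)) (C : Set (E n)) : Set (E n) :=
  H.reflection '' C

/-- `C` is symmetric with respect to `H`: `R_H C = C`. -/
def IsSymmetricAbout {n : ℕ} (H : Submodule ℝ (E n)) (C : Set (E n)) : Prop :=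
  reflectSet H C = C

/-- The affine subspace `Hᗮ + x`, as a set. -/
def orthFiber {n : ℕ} (H : Submodule ℝ (E n)) (x : E n) : Set (E n) :=
  {x} + (Hᗮ : Set (E n))

/-- The fiber symmetral
`F_H C = ⋃ x ∈ H, [½ (C ∩ (Hᗮ + x)) + ½ (R_H C ∩ (Hᗮ + x))]`
(dilations and Minkowski sums of sets are pointwise). -/
noncomputable def fiberSymmetral {n : ℕ} (H : Submodule ℝ (E n)) (C : Set (E n)) : Set (E n) :=
  ⋃ x ∈ H, ((1 / 2 : ℝ) • (C ∩ orthFiber H x)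
    + (1 / 2 : ℝ) • (reflectSet H C ∩ orthFiber H x))

/-- The iterated fiber symmetrals along the sequence `H 0, H 1, H 2, …`:
`iterSymmetral H C m = F_{H (m-1)} ⋯ F_{H 1} F_{H 0} C`. -/
noncomputable def iterSymmetral {n : ℕ} (H : ℕ → Submodule ℝ (E n)) (C : Set (E n)) :
    ℕ → Set (E n)
  | 0 => C
  | m + 1 => fiberSymmetral (H m) (iterSymmetral H C m)

/-- Convergence of a sequence of sets in the Hausdorff metric. The extended distance is used, so
that empty or unbounded sets are not at distance zero from everything. -/
def HausdorffTendsto {n : ℕ} (A : ℕ → Set (E n)) (L : Set (E n)) : Prop :=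
  Filter.Tendsto (fun m => Metric.hausdorffEDist (A m) L) Filter.atTop (𝓝 0)

end FiberSymm

/-! ### Elementary properties of the fiber symmetral. -/

namespace FiberSymm

variable {n : ℕ} {H : Submodule ℝ (E n)} {C D : Set (E n)}

/-! The first symmetrization already erases the difference between `K` and its convex hull. If `a`,
`b` have the same projection `x` on `H`, the point they contribute to `F_H` is `x + (a - b)/2`, so
only `x` and `a - b` matter. In codimension at least two the pair can be translated inside its fiber
until both points lie on the boundary of the hull, hence in `K` (`exists_frontier_pair`,
`fiberSymmetral_convexHull`).

For a convex body the tool is the energy, the integral over the unit ball of `exp` of the support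
function. It is continuous, strictly monotone under inclusion of convex bodies, and nonincreasing
under `F_Q`; strict convexity of `exp` makes `symmEnergy Q` equal to it only at bodies symmetric
about `Q`. Blaschke selection gives a subsequential limit `L`, whose energy is the limit of all the
energies. As the family is finite, `L` is symmetric about all but finitely many `H m`
(`eventually_isSymmetricAbout`). Neighbourhoods of `L` are then preserved by the late
symmetrizations, so every other limit lies in `L` and has the same energy, hence equals `L`. -/

theorem mem_orthFiber_iff {x y : E n} (hx : x ∈ H) :
    y ∈ orthFiber H x ↔ H.starProjection y = x := by
  rw [orthFiber, Set.singleton_add]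
  constructor
  · rintro ⟨v, hv, rfl⟩
    exact Submodule.eq_starProjection_of_mem_of_inner_eq_zero hx
      fun w hw => by
        simpa using Submodule.inner_left_of_mem_orthogonal hw hv
  · rintro rfl
    exact ⟨y - H.starProjection y, H.sub_starProjection_mem_orthogonal y, by simp⟩

theorem starProjection_reflection (y : E n) :
    H.starProjection (H.reflection y) = H.starProjection y := by
  rw [Submodule.reflection_apply, map_sub, map_nsmul,
    H.starProjection_eq_self_iff.2 (H.starProjection_apply_mem y), two_smul, add_sub_cancel_right]

theorem mem_fiberSymmetral_iff {w : E n} :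
    w ∈ fiberSymmetral H C ↔ ∃ a ∈ C, ∃ b ∈ C, H.starProjection a = H.starProjection b ∧
      (1 / 2 : ℝ) • a + (1 / 2 : ℝ) • H.reflection b = w := by
  simp only [fiberSymmetral, Set.mem_iUnion, Set.mem_add, Set.mem_smul_set, reflectSet]
  constructor
  · rintro ⟨x, hx, _, ⟨a, ⟨ha, hax⟩, rfl⟩, _, ⟨_, ⟨⟨b, hb, rfl⟩, hbx⟩, rfl⟩, rfl⟩
    rw [mem_orthFiber_iff hx] at hax hbx
    rw [starProjection_reflection] at hbx
    exact ⟨a, ha, b, hb, hax.trans hbx.symm, rfl⟩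
  · rintro ⟨a, ha, b, hb, hab, rfl⟩
    have hx := H.starProjection_apply_mem a
    refine ⟨_, hx, _, ⟨a, ⟨ha, (mem_orthFiber_iff hx).2 rfl⟩, rfl⟩, _,
      ⟨_, ⟨⟨b, hb, rfl⟩, (mem_orthFiber_iff hx).2 ?_⟩, rfl⟩, rfl⟩
    rw [starProjection_reflection, hab]

theorem fiberSymmetral_mono (h : C ⊆ D) : fiberSymmetral H C ⊆ fiberSymmetral H D := by
  intro w hw
  obtain ⟨a, ha, b, hb, hab, rfl⟩ := mem_fiberSymmetral_iff.1 hw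
  exact mem_fiberSymmetral_iff.2 ⟨a, h ha, b, h hb, hab, rfl⟩

theorem fiberSymmetral_eq_image : fiberSymmetral H C =
    (fun p : E n × E n => (1 / 2 : ℝ) • p.1 + (1 / 2 : ℝ) • H.reflection p.2) ''
      ((C ×ˢ C) ∩ {p | H.starProjection p.1 = H.starProjection p.2}) := by
  ext w
  rw [mem_fiberSymmetral_iff]
  constructor
  · rintro ⟨a, ha, b, hb, hab, rfl⟩
    exact ⟨(a, b), ⟨⟨ha, hb⟩, hab⟩, rfl⟩
  · rintro ⟨⟨a, b⟩, ⟨⟨ha, hb⟩, hab⟩, rfl⟩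
    exact ⟨a, ha, b, hb, hab, rfl⟩

theorem _root_.IsCompact.fiberSymmetral (hC : IsCompact C) :
    IsCompact (fiberSymmetral H C) := by
  rw [fiberSymmetral_eq_image]
  refine ((hC.prod hC).inter_right (isClosed_eq ?_ ?_)).image ?_ <;> fun_prop

theorem _root_.Set.Nonempty.fiberSymmetral (hC : C.Nonempty) :
    (fiberSymmetral H C).Nonempty := by
  obtain ⟨a, ha⟩ := hC
  exact ⟨_, mem_fiberSymmetral_iff.2 ⟨a, ha, a, ha, rfl, rfl⟩⟩

theorem _root_.Convex.fiberSymmetral (hC : Convex ℝ C) :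
    Convex ℝ (fiberSymmetral H C) := by
  intro x hx y hy s t hs ht hst
  obtain ⟨a, ha, b, hb, hab, rfl⟩ := mem_fiberSymmetral_iff.1 hx
  obtain ⟨a', ha', b', hb', hab', rfl⟩ := mem_fiberSymmetral_iff.1 hy
  refine mem_fiberSymmetral_iff.2 ⟨s • a + t • a', hC ha ha' hs ht hst, s • b + t • b',
    hC hb hb' hs ht hst, by simp [hab, hab'], ?_⟩
  simp only [map_add, map_smul]
  module

theorem IsSymmetricAbout.reflection_mem (hD : IsSymmetricAbout H D) {x : E n} (hx : x ∈ D) :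
    H.reflection x ∈ D := by
  rw [← hD]
  exact ⟨x, hx, rfl⟩

theorem fiberSymmetral_subset (hD : Convex ℝ D) (hsym : IsSymmetricAbout H D) (h : C ⊆ D) :
    fiberSymmetral H C ⊆ D := by
  intro w hw
  obtain ⟨a, ha, b, hb, -, rfl⟩ := mem_fiberSymmetral_iff.1 hw
  exact hD (h ha) (hsym.reflection_mem (h hb)) (by norm_num) (by norm_num) (by norm_num)

theorem isSymmetricAbout_of_reflection_mem (h : ∀ x ∈ D, H.reflection x ∈ D) :
    IsSymmetricAbout H D := by
  apply subset_antisymm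
  · rintro _ ⟨x, hx, rfl⟩
    exact h x hx
  · intro x hx
    exact ⟨_, h x hx, H.reflection_reflection x⟩

theorem isSymmetricAbout_closedBall (r : ℝ) :
    IsSymmetricAbout H (Metric.closedBall (0 : E n) r) :=
  isSymmetricAbout_of_reflection_mem fun x hx => by simpa using hx

theorem IsSymmetricAbout.cthickening (hD : IsSymmetricAbout H D) (ε : ℝ) :
    IsSymmetricAbout H (Metric.cthickening ε D) := by
  refine isSymmetricAbout_of_reflection_mem fun x hx => ?_
  rw [Metric.mem_cthickening_iff] at hx ⊢
  rw [← hD, reflectSet, Metric.infEDist_image H.reflection.isometry]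
  exact hx

/-! ### Replacing pairs in a fiber by boundary pairs. -/

/-- If `q` is an interior point of a convex set containing `p`, then both `p` and `q` can be moved
within the set by the same small positive multiple of a perturbation of `q - p`. -/
theorem exists_smul_add_mem_of_mem_interior (hC : Convex ℝ C) {p q : E n} (hp : p ∈ C)
    (hq : q ∈ interior C) (u : E n) :
    ∃ t > (0 : ℝ), ∃ ε > (0 : ℝ), p + t • (ε • u + (q - p)) ∈ C ∧
      q + t • (ε • u + (q - p)) ∈ C := by
  have h1 : ∀ᶠ ε in 𝓝[>] (0 : ℝ), q + ε • u ∈ C := by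
    have : Filter.Tendsto (fun ε : ℝ => q + ε • u) (𝓝[>] 0) (𝓝 q) := by
      have : ContinuousAt (fun ε : ℝ => q + ε • u) 0 := by fun_prop
      simpa [ContinuousAt] using this.mono_left nhdsWithin_le_nhds
    exact this (mem_interior_iff_mem_nhds.1 hq)
  obtain ⟨ε, hε, hε0⟩ := (h1.and self_mem_nhdsWithin).exists
  have h2 : ∀ᶠ t in 𝓝[>] (0 : ℝ), q + t • (ε • u + (q - p)) ∈ C := by
    have : Filter.Tendsto (fun t : ℝ => q + t • (ε • u + (q - p))) (𝓝[>] 0) (𝓝 q) := by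
      have : ContinuousAt (fun t : ℝ => q + t • (ε • u + (q - p))) 0 := by fun_prop
      simpa [ContinuousAt] using this.mono_left nhdsWithin_le_nhds
    exact this (mem_interior_iff_mem_nhds.1 hq)
  obtain ⟨t, ⟨ht, ht1⟩, ht0⟩ :=
    ((h2.and (Ioc_mem_nhdsGT one_pos)).and self_mem_nhdsWithin).exists
  refine ⟨t, ht0, ε, hε0, ?_, ht⟩
  -- The shifted `p` is the convex combination `(1 - t) • p + t • (q + ε • u)`.
  have := hC hp hε (sub_nonneg.2 ht1.2) (le_of_lt ht0) (by ring)
  convert this using 1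
  module

/-- This is where codimension two enters: `H` together with one more vector still does not span the
space. -/
theorem exists_ne_zero_mem_orthogonal (hH : Module.finrank ℝ H + 2 ≤ n) (z : E n) :
    ∃ u : E n, u ≠ 0 ∧ u ∈ Hᗮ ∧ inner ℝ u z = 0 := by
  have hlt : Module.finrank ℝ ↥(H ⊔ Submodule.span ℝ {z}) < Module.finrank ℝ (E n) := by
    have h1 := Submodule.finrank_add_le_finrank_add_finrank H (Submodule.span ℝ {z})
    have h2 : Module.finrank ℝ (Submodule.span ℝ {z}) ≤ 1 := by
      simpa using finrank_span_le_card (R := ℝ) ({z} : Set (E n))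
    have h3 : Module.finrank ℝ (E n) = n := by simp
    omega
  have hne : (H ⊔ Submodule.span ℝ {z})ᗮ ≠ ⊥ := by
    intro h
    rw [Submodule.orthogonal_eq_bot_iff] at h
    rw [h, finrank_top] at hlt
    exact lt_irrefl _ hlt
  obtain ⟨u, hu, hu0⟩ := Submodule.exists_mem_ne_zero_of_ne_bot hne
  refine ⟨u, hu0, Submodule.orthogonal_le le_sup_left hu, ?_⟩
  exact Submodule.inner_left_of_mem_orthogonal
    ((le_sup_right : _ ≤ H ⊔ Submodule.span ℝ {z}) (Submodule.mem_span_singleton_self z)) hu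

/-- A difference of two points in a fiber of a compact convex set, in codimension at least two, is a
difference of two boundary points in the same fiber. -/
theorem exists_frontier_pair (hH : Module.finrank ℝ H + 2 ≤ n) (hC : IsCompact C)
    (hconv : Convex ℝ C) {a b : E n} (ha : a ∈ C) (hb : b ∈ C)
    (hab : H.starProjection a = H.starProjection b) :
    ∃ a' ∈ frontier C, ∃ b' ∈ frontier C, a' - b' = a - b ∧
      H.starProjection a' = H.starProjection a := by
  obtain ⟨u, hu0, huH, huz⟩ := exists_ne_zero_mem_orthogonal hH (a - b)
  have hPu : H.starProjection u = 0 := H.starProjection_apply_eq_zero_iff.2 huH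
  have hPz : H.starProjection (a - b) = 0 := by simp [hab]
  have huu : 0 < inner ℝ u u := by
    rw [real_inner_self_eq_norm_sq]; positivity
  -- `N` collects the admissible positions `q` of the first point, the second being `q - (a - b)`. A
  -- position maximizing `inner ℝ u q` will have both points on the frontier.
  let N : Set (E n) := (C ∩ {q | H.starProjection q = H.starProjection a}) ∩
    (fun q => q - (a - b)) ⁻¹' C
  have hN : IsCompact N :=
    (hC.inter_right (isClosed_eq (by fun_prop) (by fun_prop))).inter_right
      (hC.isClosed.preimage (by fun_prop))
  obtain ⟨q, ⟨⟨hqC, hqP⟩, hqz⟩, hmax⟩ := hN.exists_isMaxOn (f := fun q => inner ℝ u q)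
    ⟨a, ⟨ha, rfl⟩, by simpa using hb⟩ (by fun_prop)
  have key : ∀ t > (0 : ℝ), ∀ ε > (0 : ℝ), ∀ v : E n, H.starProjection v = 0 →
      inner ℝ u v = 0 → q + t • (ε • u + v) ∈ C → q - (a - b) + t • (ε • u + v) ∈ C → False := by
    intro t ht ε hε v hPv huv h1 h2
    have hmem : q + t • (ε • u + v) ∈ N := by
      refine ⟨⟨h1, ?_⟩, ?_⟩
      · simpa [hPu, hPv] using hqP
      · change q + t • (ε • u + v) - (a - b) ∈ C
        convert h2 using 1
        abel
    have := hmax hmem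
    simp only [Set.mem_ofPred_eq, inner_add_right, inner_smul_right, huv] at this
    have : 0 < t * (ε * inner ℝ u u) := by positivity
    linarith
  -- If either point were interior, a common shift towards it, tilted by `ε • u`, would keep both
  -- points in `C` and the fiber while increasing the inner product with `u`.
  refine ⟨q, ⟨subset_closure hqC, fun hint => ?_⟩, q - (a - b), ⟨subset_closure hqz, fun hint => ?_⟩,
    by abel, hqP⟩
  · obtain ⟨t, ht, ε, hε, h1, h2⟩ := exists_smul_add_mem_of_mem_interior hconv hqz hint u
    exact key t ht ε hε _ (by simpa using hPz) (by simpa using huz) h2 h1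
  · obtain ⟨t, ht, ε, hε, h1, h2⟩ := exists_smul_add_mem_of_mem_interior hconv hqC hint u
    refine key t ht ε hε _ ?_ ?_ h1 h2
    · rw [sub_sub_cancel_left, map_neg, hPz, neg_zero]
    · rw [sub_sub_cancel_left, inner_neg_right, huz, neg_zero]

theorem isCompact_convexHull_of_frontier_subset {K : Set (E n)} (hK : IsCompact K)
    (hbd : frontier (convexHull ℝ K) ⊆ K) : IsCompact (convexHull ℝ K) := by
  refine Metric.isCompact_of_isClosed_isBounded ?_ (isBounded_convexHull.2 hK.isBounded)
  rw [← frontier_subset_iff_isClosed]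
  exact hbd.trans (subset_convexHull ℝ K)

/-- The contribution of `a`, `b` is their common projection plus `(a - b)/2`, and a boundary pair
with the same data exists. -/
theorem fiberSymmetral_convexHull (hH : Module.finrank ℝ H + 2 ≤ n) {K : Set (E n)}
    (hK : IsCompact K) (hbd : frontier (convexHull ℝ K) ⊆ K) :
    fiberSymmetral H (convexHull ℝ K) = fiberSymmetral H K := by
  refine subset_antisymm (fun w hw => ?_) (fiberSymmetral_mono (subset_convexHull ℝ K))
  obtain ⟨a, ha, b, hb, hab, rfl⟩ := mem_fiberSymmetral_iff.1 hw
  obtain ⟨a', ha', b', hb', hsub, hP⟩ := exists_frontier_pair hH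
    (isCompact_convexHull_of_frontier_subset hK hbd) (convex_convexHull ℝ K) ha hb hab
  have hP' : H.starProjection b' = H.starProjection a' := by
    have := congrArg H.starProjection hsub
    rw [map_sub, map_sub, hab, sub_self, sub_eq_zero] at this
    exact this.symm
  refine mem_fiberSymmetral_iff.2 ⟨a', hbd ha', b', hbd hb', hP'.symm, ?_⟩
  rw [sub_eq_iff_eq_add] at hsub
  simp only [Submodule.reflection_apply, hP', hP, ← hab]
  rw [hsub]
  module

end FiberSymm

/-! ### Support functions. -/

namespace FiberSymm
open TopologicalSpace MeasureTheory

variable {n : ℕ}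

/-- The support function of a nonempty compact set. -/
noncomputable def supportFun (K : NonemptyCompacts (E n)) (u : E n) : ℝ :=
  sSup ((fun x => inner ℝ x u) '' (K : Set (E n)))

theorem inner_le_supportFun {K : NonemptyCompacts (E n)} {x : E n} (hx : x ∈ K) (u : E n) :
    inner ℝ x u ≤ supportFun K u :=
  le_csSup (K.isCompact.image (by fun_prop)).bddAbove ⟨x, hx, rfl⟩

theorem supportFun_le {K : NonemptyCompacts (E n)} {u : E n} {c : ℝ}
    (h : ∀ x ∈ K, inner ℝ x u ≤ c) : supportFun K u ≤ c := by
  refine csSup_le (K.nonempty.image _) ?_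
  rintro _ ⟨x, hx, rfl⟩
  exact h x hx

theorem supportFun_mono {K L : NonemptyCompacts (E n)} (h : (K : Set (E n)) ⊆ L) (u : E n) :
    supportFun K u ≤ supportFun L u :=
  supportFun_le fun _ hx => inner_le_supportFun (h hx) u

theorem supportFun_smul_le (K : NonemptyCompacts (E n)) {c : ℝ} (hc : 0 ≤ c) (u : E n) :
    supportFun K (c • u) ≤ c * supportFun K u :=
  supportFun_le fun x hx => by
    rw [inner_smul_right]
    exact mul_le_mul_of_nonneg_left (inner_le_supportFun hx u) hc

theorem supportFun_smul (K : NonemptyCompacts (E n)) {c : ℝ} (hc : 0 < c) (u : E n) :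
    supportFun K (c • u) = c * supportFun K u := by
  refine le_antisymm (supportFun_smul_le K hc.le u) ?_
  have := supportFun_smul_le K (inv_nonneg.2 hc.le) (c • u)
  rwa [inv_smul_smul₀ hc.ne', le_inv_mul_iff₀ hc] at this

theorem exists_dist_le_dist {K L : NonemptyCompacts (E n)} {x : E n} (hx : x ∈ K) :
    ∃ y ∈ L, dist x y ≤ dist K L := by
  obtain ⟨y, hy, hxy⟩ := L.isCompact.exists_infDist_eq_dist L.nonempty x
  refine ⟨y, hy, hxy ▸ ?_⟩
  exact Metric.infDist_le_hausdorffDist_of_mem hx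
    (Metric.hausdorffEDist_ne_top_of_nonempty_of_bounded K.nonempty L.nonempty
      K.isCompact.isBounded L.isCompact.isBounded)

/-- Only `L` is required to be bounded by `r`, so the estimate gives joint continuity at `(L, v)`
with a fixed `r`. -/
theorem abs_supportFun_sub_le {K L : NonemptyCompacts (E n)} {r : ℝ}
    (hr : ∀ y ∈ L, ‖y‖ ≤ r) (u v : E n) :
    |supportFun K u - supportFun L v| ≤ dist K L * ‖u‖ + r * ‖u - v‖ := by
  have key : ∀ x y : E n, y ∈ L → dist x y ≤ dist K L →
      |inner ℝ x u - inner ℝ y v| ≤ dist K L * ‖u‖ + r * ‖u - v‖ := by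
    intro x y hy hxy
    have : inner ℝ x u - inner ℝ y v = inner ℝ (x - y) u + inner ℝ y (u - v) := by
      rw [inner_sub_left, inner_sub_right]; ring
    rw [this]
    refine (abs_add_le _ _).trans (add_le_add ?_ ?_)
    · refine (abs_real_inner_le_norm _ _).trans ?_
      rw [dist_eq_norm] at hxy
      gcongr
    · refine (abs_real_inner_le_norm _ _).trans ?_
      have := hr y hy
      gcongr
  rw [abs_le]
  constructor
  · suffices supportFun L v ≤ supportFun K u + (dist K L * ‖u‖ + r * ‖u - v‖) by linarith
    refine supportFun_le fun y hy => ?_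
    obtain ⟨x, hx, hxy⟩ := exists_dist_le_dist (L := K) hy
    have h1 := (abs_le.1 (key x y hy (by rwa [dist_comm x, dist_comm K]))).1
    have h2 := inner_le_supportFun hx u
    linarith
  · suffices supportFun K u ≤ supportFun L v + (dist K L * ‖u‖ + r * ‖u - v‖) by linarith
    refine supportFun_le fun x hx => ?_
    obtain ⟨y, hy, hxy⟩ := exists_dist_le_dist (L := L) hx
    have h1 := (abs_le.1 (key x y hy hxy)).2
    have h2 := inner_le_supportFun hy v
    linarith

theorem continuous_supportFun :
    Continuous fun p : NonemptyCompacts (E n) × E n => supportFun p.1 p.2 := by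
  rw [continuous_iff_continuousAt]
  rintro ⟨L, v⟩
  obtain ⟨r, hr⟩ := L.isCompact.isBounded.exists_norm_le
  rw [ContinuousAt, tendsto_iff_dist_tendsto_zero]
  have hlim : Filter.Tendsto (fun p : NonemptyCompacts (E n) × E n =>
      dist p.1 L * ‖p.2‖ + r * ‖p.2 - v‖) (𝓝 (L, v)) (𝓝 0) := by
    have : ContinuousAt (fun p : NonemptyCompacts (E n) × E n =>
      dist p.1 L * ‖p.2‖ + r * ‖p.2 - v‖) (L, v) := by fun_prop
    simpa [ContinuousAt] using this
  exact squeeze_zero (fun _ => dist_nonneg) (fun p => abs_supportFun_sub_le hr p.2 v) hlim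

@[fun_prop]
theorem _root_.Continuous.supportFun {X : Type*} [TopologicalSpace X]
    {f : X → NonemptyCompacts (E n)} {g : X → E n} (hf : Continuous f) (hg : Continuous g) :
    Continuous fun x => FiberSymm.supportFun (f x) (g x) :=
  continuous_supportFun.comp (hf.prodMk hg)

theorem mem_of_inner_le_supportFun {L : NonemptyCompacts (E n)} (hL : Convex ℝ (L : Set (E n)))
    {x : E n} (h : ∀ u, inner ℝ x u ≤ supportFun L u) : x ∈ L := by
  by_contra hx
  obtain ⟨f, c, hf, hc⟩ := geometric_hahn_banach_closed_point hL L.isCompact.isClosed hx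
  have hinner : ∀ y, f y = inner ℝ y ((InnerProductSpace.toDual ℝ (E n)).symm f) := by
    intro y
    rw [real_inner_comm, InnerProductSpace.toDual_symm_apply]
  have h1 : supportFun L ((InnerProductSpace.toDual ℝ (E n)).symm f) ≤ c :=
    supportFun_le fun y hy => by
      rw [← hinner]
      exact (hf y hy).le
  have h2 := h ((InnerProductSpace.toDual ℝ (E n)).symm f)
  rw [← hinner] at h2
  linarith

/-! ### The exponential energy and its equality cases. -/

theorem integrableOn_closedBall {f : E n → ℝ} (hf : Continuous f) :
    IntegrableOn f (Metric.closedBall 0 1) :=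
  hf.continuousOn.integrableOn_compact (isCompact_closedBall _ _)

theorem setIntegral_closedBall_mono {f g : E n → ℝ} (hf : Continuous f) (hg : Continuous g)
    (hfg : ∀ u, f u ≤ g u) :
    ∫ u in Metric.closedBall 0 1, f u ≤ ∫ u in Metric.closedBall 0 1, g u :=
  setIntegral_mono_on (integrableOn_closedBall hf) (integrableOn_closedBall hg)
    measurableSet_closedBall fun u _ => hfg u

theorem eqOn_ball_of_setIntegral_eq {f g : E n → ℝ} (hf : Continuous f) (hg : Continuous g)
    (hfg : ∀ u, f u ≤ g u)
    (h : ∫ u in Metric.closedBall 0 1, f u = ∫ u in Metric.closedBall 0 1, g u) :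
    Set.EqOn f g (Metric.ball 0 1) := by
  have h1 := (integral_eq_iff_of_ae_le (integrableOn_closedBall hf) (integrableOn_closedBall hg)
    (Filter.Eventually.of_forall hfg)).1 h
  exact Measure.eqOn_open_of_ae_eq
    (ae_restrict_of_ae_restrict_of_subset Metric.ball_subset_closedBall h1) Metric.isOpen_ball
    hf.continuousOn hg.continuousOn

theorem setIntegral_closedBall_comp (R : E n ≃ₗᵢ[ℝ] E n) (f : E n → ℝ) :
    ∫ u in Metric.closedBall 0 1, f (R u) = ∫ u in Metric.closedBall 0 1, f u := by
  have := R.measurePreserving.setIntegral_preimage_emb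
    R.toHomeomorph.measurableEmbedding f (Metric.closedBall 0 1)
  rwa [R.preimage_closedBall, map_zero] at this

/-- With positive homogeneity, this extends identities between support functions from the unit ball
to all vectors. -/
theorem exists_smul_mem_ball (u : E n) : ∃ c > (0 : ℝ), c • u ∈ Metric.ball (0 : E n) 1 := by
  refine ⟨(‖u‖ + 1)⁻¹, by positivity, ?_⟩
  rw [mem_ball_zero_iff, norm_smul, norm_inv, Real.norm_of_nonneg (by positivity),
    inv_mul_lt_one₀ (by positivity)]
  linarith

/-- The integral over the unit ball of the exponential of the support function. -/
noncomputable def energy (K : NonemptyCompacts (E n)) : ℝ :=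
  ∫ u in Metric.closedBall (0 : E n) 1, Real.exp (supportFun K u)

/-- The energy of the Minkowski symmetral of `K`, written through the support function of `K`. -/
noncomputable def symmEnergy (Q : Submodule ℝ (E n)) (K : NonemptyCompacts (E n)) : ℝ :=
  ∫ u in Metric.closedBall (0 : E n) 1,
    Real.exp ((supportFun K u + supportFun K (Q.reflection u)) / 2)

theorem continuous_energy : Continuous (energy (n := n)) := by
  refine continuous_parametric_integral_of_continuous
    (f := fun (K : NonemptyCompacts (E n)) u => Real.exp (supportFun K u)) ?_
    (isCompact_closedBall _ _)
  exact Real.continuous_exp.comp (Continuous.supportFun continuous_fst continuous_snd)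

theorem continuous_symmEnergy (Q : Submodule ℝ (E n)) : Continuous (symmEnergy Q) := by
  refine continuous_parametric_integral_of_continuous
    (f := fun (K : NonemptyCompacts (E n)) u =>
      Real.exp ((supportFun K u + supportFun K (Q.reflection u)) / 2)) ?_
    (isCompact_closedBall _ _)
  refine Real.continuous_exp.comp (Continuous.div_const (Continuous.add
    (Continuous.supportFun continuous_fst continuous_snd)
    (Continuous.supportFun continuous_fst ?_)) 2)
  exact Q.reflection.continuous.comp continuous_snd

theorem energy_nonneg (K : NonemptyCompacts (E n)) : 0 ≤ energy K :=
  integral_nonneg fun _ => (Real.exp_pos _).le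

theorem continuous_supportFun_right (K : NonemptyCompacts (E n)) : Continuous (supportFun K) :=
  Continuous.supportFun continuous_const continuous_id

theorem continuous_supportFun_reflection (Q : Submodule ℝ (E n)) (K : NonemptyCompacts (E n)) :
    Continuous fun u => supportFun K (Q.reflection u) :=
  (continuous_supportFun_right K).comp Q.reflection.continuous

theorem eq_of_subset_of_energy_eq {K L : NonemptyCompacts (E n)} (hK : Convex ℝ (K : Set (E n)))
    (hsub : (K : Set (E n)) ⊆ L) (h : energy K = energy L) : K = L := by
  have heq := eqOn_ball_of_setIntegral_eq (Real.continuous_exp.comp (continuous_supportFun_right K))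
    (Real.continuous_exp.comp (continuous_supportFun_right L))
    (fun u => Real.exp_le_exp.2 (supportFun_mono hsub u)) h
  refine SetLike.coe_injective (subset_antisymm hsub fun x hx =>
    mem_of_inner_le_supportFun hK fun u => ?_)
  obtain ⟨c, hc, hcu⟩ := exists_smul_mem_ball u
  have h1 := Real.exp_injective (heq hcu)
  rw [supportFun_smul _ hc, supportFun_smul _ hc] at h1
  rw [mul_left_cancel₀ hc.ne' h1]
  exact inner_le_supportFun hx u

/-- `F_Q K` lies in the Minkowski symmetral `½ K + ½ R_Q K`, whose support function is the average
in the exponent. -/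
theorem energy_le_symmEnergy {Q : Submodule ℝ (E n)} {K L : NonemptyCompacts (E n)}
    (hL : (L : Set (E n)) = fiberSymmetral Q K) : energy L ≤ symmEnergy Q K := by
  refine setIntegral_closedBall_mono (Real.continuous_exp.comp (continuous_supportFun_right L))
    (Real.continuous_exp.comp (((continuous_supportFun_right K).add
      (continuous_supportFun_reflection Q K)).div_const 2)) fun u => Real.exp_le_exp.2 ?_
  refine supportFun_le fun x hx => ?_
  have hx' : x ∈ (L : Set (E n)) := hx
  rw [hL] at hx'
  obtain ⟨a, ha, b, hb, -, rfl⟩ := mem_fiberSymmetral_iff.1 hx'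
  have h1 := inner_le_supportFun ha u
  have h2 := inner_le_supportFun hb (Q.reflection u)
  have h3 : inner ℝ (Q.reflection b) u = inner ℝ b (Q.reflection u) := by
    rw [← Q.reflection.inner_map_map b, Q.reflection_reflection]
  rw [inner_add_left, real_inner_smul_left, real_inner_smul_left, h3]
  linarith

/-- The explicit square defect yields both the midpoint inequality and its equality case. -/
theorem exp_half_add_eq (a b : ℝ) : Real.exp ((a + b) / 2) =
    (Real.exp a + Real.exp b) / 2 - (Real.exp (a / 2) - Real.exp (b / 2)) ^ 2 / 2 := by
  have h1 : Real.exp a = Real.exp (a / 2) ^ 2 := by rw [← Real.exp_nat_mul]; congr 1; push_cast; ring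
  have h2 : Real.exp b = Real.exp (b / 2) ^ 2 := by rw [← Real.exp_nat_mul]; congr 1; push_cast; ring
  rw [add_div, Real.exp_add, h1, h2]
  ring

theorem exp_half_add_le (a b : ℝ) :
    Real.exp ((a + b) / 2) ≤ (Real.exp a + Real.exp b) / 2 := by
  rw [exp_half_add_eq]
  exact sub_le_self _ (by positivity)

theorem setIntegral_exp_supportFun_average (Q : Submodule ℝ (E n)) (K : NonemptyCompacts (E n)) :
    ∫ u in Metric.closedBall (0 : E n) 1,
      (Real.exp (supportFun K u) + Real.exp (supportFun K (Q.reflection u))) / 2 = energy K := by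
  have h1 : IntegrableOn (fun u => Real.exp (supportFun K u)) (Metric.closedBall 0 1) :=
    integrableOn_closedBall (Real.continuous_exp.comp (continuous_supportFun_right K))
  have h2 : IntegrableOn (fun u => Real.exp (supportFun K (Q.reflection u)))
      (Metric.closedBall 0 1) :=
    integrableOn_closedBall (Real.continuous_exp.comp (continuous_supportFun_reflection Q K))
  rw [integral_div, integral_add h1 h2,
    setIntegral_closedBall_comp Q.reflection (fun u => Real.exp (supportFun K u)), energy]
  ring

theorem symmEnergy_le_energy (Q : Submodule ℝ (E n)) (K : NonemptyCompacts (E n)) :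
    symmEnergy Q K ≤ energy K := by
  rw [← setIntegral_exp_supportFun_average Q K]
  refine setIntegral_closedBall_mono
    (Real.continuous_exp.comp (((continuous_supportFun_right K).add
      (continuous_supportFun_reflection Q K)).div_const 2))
    (((Real.continuous_exp.comp (continuous_supportFun_right K)).add
      (Real.continuous_exp.comp (continuous_supportFun_reflection Q K))).div_const 2) fun u => ?_
  exact exp_half_add_le _ _

/-- Equality of the integrals kills the square defect, so the support function is invariant under
the reflection. -/
theorem isSymmetricAbout_of_symmEnergy_eq {Q : Submodule ℝ (E n)} {K : NonemptyCompacts (E n)}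
    (hK : Convex ℝ (K : Set (E n))) (h : symmEnergy Q K = energy K) :
    IsSymmetricAbout Q (K : Set (E n)) := by
  rw [← setIntegral_exp_supportFun_average Q K] at h
  have heq := eqOn_ball_of_setIntegral_eq
    (Real.continuous_exp.comp (((continuous_supportFun_right K).add
      (continuous_supportFun_reflection Q K)).div_const 2))
    (((Real.continuous_exp.comp (continuous_supportFun_right K)).add
      (Real.continuous_exp.comp (continuous_supportFun_reflection Q K))).div_const 2)
    (fun u => exp_half_add_le _ _) h
  have hR : ∀ u, supportFun K (Q.reflection u) = supportFun K u := by
    intro u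
    obtain ⟨c, hc, hcu⟩ := exists_smul_mem_ball u
    have h1 := heq hcu
    simp only [Function.comp_apply, Pi.add_apply] at h1
    rw [exp_half_add_eq, sub_eq_self, div_eq_zero_iff, or_iff_left two_ne_zero, sq_eq_zero_iff,
      sub_eq_zero, Real.exp_eq_exp, map_smul, supportFun_smul _ hc, supportFun_smul _ hc] at h1
    have : c * (supportFun K (Q.reflection u) - supportFun K u) = 0 := by linarith
    rcases mul_eq_zero.1 this with h2 | h2
    · exact absurd h2 hc.ne'
    · exact sub_eq_zero.1 h2
  refine isSymmetricAbout_of_reflection_mem fun x hx => mem_of_inner_le_supportFun hK fun u => ?_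
  rw [← Q.reflection.inner_map_map, Q.reflection_reflection, ← hR u]
  exact inner_le_supportFun hx _

end FiberSymm

/-! ### Hausdorff limits of convex bodies. -/

namespace FiberSymm
open TopologicalSpace Filter

variable {n : ℕ}

theorem subset_cthickening_dist (K L : NonemptyCompacts (E n)) :
    (K : Set (E n)) ⊆ Metric.cthickening (dist K L) (L : Set (E n)) := by
  intro x hx
  obtain ⟨y, hy, hxy⟩ := exists_dist_le_dist (L := L) hx
  exact Metric.mem_cthickening_of_dist_le x y _ _ hy hxy

theorem eventually_subset_cthickening {A : ℕ → NonemptyCompacts (E n)}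
    {L : NonemptyCompacts (E n)} (hA : Tendsto A atTop (𝓝 L)) {ε : ℝ} (hε : 0 < ε) :
    ∀ᶠ k in atTop, (A k : Set (E n)) ⊆ Metric.cthickening ε (L : Set (E n)) := by
  filter_upwards [Metric.tendsto_nhds.1 hA ε hε] with k hk
  exact (subset_cthickening_dist _ _).trans (Metric.cthickening_mono hk.le _)

theorem subset_of_forall_subset_cthickening {S L : Set (E n)} (hL : IsClosed L)
    (h : ∀ ε > (0 : ℝ), S ⊆ Metric.cthickening ε L) : S ⊆ L := by
  rw [← hL.closure_eq, Metric.closure_eq_iInter_cthickening]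
  exact Set.subset_iInter₂ h

theorem subset_of_tendsto {A : ℕ → NonemptyCompacts (E n)} {L : NonemptyCompacts (E n)}
    (hA : Tendsto A atTop (𝓝 L)) {S : Set (E n)} (hS : IsClosed S)
    (h : ∀ᶠ k in atTop, (A k : Set (E n)) ⊆ S) : (L : Set (E n)) ⊆ S := by
  refine subset_of_forall_subset_cthickening hS fun ε hε => ?_
  obtain ⟨k, hk, hkS⟩ := ((Metric.tendsto_nhds.1 hA ε hε).and h).exists
  rw [dist_comm] at hk
  exact ((subset_cthickening_dist _ _).trans (Metric.cthickening_mono hk.le _)).trans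
    (Metric.cthickening_subset_of_subset ε hkS)

theorem convex_of_tendsto {A : ℕ → NonemptyCompacts (E n)} {L : NonemptyCompacts (E n)}
    (hA : Tendsto A atTop (𝓝 L)) (h : ∀ k, Convex ℝ (A k : Set (E n))) :
    Convex ℝ (L : Set (E n)) := by
  rw [convex_iff_segment_subset]
  intro x hx y hy
  refine subset_of_forall_subset_cthickening L.isCompact.isClosed fun ε hε => ?_
  obtain ⟨k, hk⟩ := (Metric.tendsto_nhds.1 hA (ε / 2) (half_pos hε)).exists
  have h1 : (L : Set (E n)) ⊆ Metric.cthickening (ε / 2) (A k) := by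
    rw [dist_comm] at hk
    exact (subset_cthickening_dist _ _).trans (Metric.cthickening_mono hk.le _)
  have h2 : (A k : Set (E n)) ⊆ Metric.cthickening (ε / 2) L :=
    (subset_cthickening_dist _ _).trans (Metric.cthickening_mono hk.le _)
  refine (((h k).cthickening (ε / 2)).segment_subset (h1 hx) (h1 hy)).trans
    ((Metric.cthickening_subset_of_subset _ h2).trans ?_)
  have := Metric.cthickening_cthickening_subset (half_pos hε).le (half_pos hε).le (L : Set (E n))
  rwa [add_halves] at this

/-- A bounded sequence of convex bodies that is eventually contained in each neighbourhood of `L`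
and whose energies tend to that of `L` converges to `L`. -/
theorem tendsto_of_energy_tendsto {A : ℕ → NonemptyCompacts (E n)} {L : NonemptyCompacts (E n)}
    {r : ℝ} (hr : ∀ k, (A k : Set (E n)) ⊆ Metric.closedBall 0 r)
    (hconv : ∀ k, Convex ℝ (A k : Set (E n)))
    (hsub : ∀ ε > (0 : ℝ), ∀ᶠ k in atTop, (A k : Set (E n)) ⊆ Metric.cthickening ε (L : Set (E n)))
    (henergy : Tendsto (fun k => energy (A k)) atTop (𝓝 (energy L))) :
    Tendsto A atTop (𝓝 L) := by
  refine tendsto_of_subseq_tendsto fun ns hns => ?_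
  obtain ⟨L', -, φ, hφ, hlim⟩ :=
    (NonemptyCompacts.isCompact_subsets_of_isCompact (isCompact_closedBall (0 : E n) r)).tendsto_subseq
      (x := fun k => A (ns k)) fun k => hr (ns k)
  refine ⟨φ, ?_⟩
  have hsubseq := hns.comp hφ.tendsto_atTop
  have hL'L : (L' : Set (E n)) ⊆ L :=
    subset_of_forall_subset_cthickening L.isCompact.isClosed fun ε hε =>
      subset_of_tendsto hlim Metric.isClosed_cthickening (hsubseq.eventually (hsub ε hε))
  have hE : energy L' = energy L :=
    tendsto_nhds_unique ((continuous_energy.tendsto L').comp hlim) (henergy.comp hsubseq)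
  rw [← eq_of_subset_of_energy_eq (convex_of_tendsto hlim fun k => hconv _) hL'L hE]
  exact hlim

/-! ### Convergence of the iterated symmetrals. -/

section Iterates

variable {H : ℕ → Submodule ℝ (E n)} {C : Set (E n)}

theorem isCompact_iterSymmetral (hC : IsCompact C) : ∀ m, IsCompact (iterSymmetral H C m)
  | 0 => hC
  | m + 1 => (isCompact_iterSymmetral hC m).fiberSymmetral

theorem nonempty_iterSymmetral (hC : C.Nonempty) : ∀ m, (iterSymmetral H C m).Nonempty
  | 0 => hC
  | m + 1 => (nonempty_iterSymmetral hC m).fiberSymmetral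

theorem convex_iterSymmetral (hC : Convex ℝ C) : ∀ m, Convex ℝ (iterSymmetral H C m)
  | 0 => hC
  | m + 1 => (convex_iterSymmetral hC m).fiberSymmetral

theorem iterSymmetral_subset_closedBall {r : ℝ} (hC : C ⊆ Metric.closedBall 0 r) :
    ∀ m, iterSymmetral H C m ⊆ Metric.closedBall 0 r
  | 0 => hC
  | m + 1 => fiberSymmetral_subset (convex_closedBall _ _) (isSymmetricAbout_closedBall r)
      (iterSymmetral_subset_closedBall hC m)

/-- Applied with `D` a closed neighbourhood of a limit body, to trap the iterates near it. -/
theorem iterSymmetral_subset_of_le {D : Set (E n)} (hD : Convex ℝ D) {k m : ℕ} (hkm : k ≤ m)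
    (hsym : ∀ j, k ≤ j → j < m → IsSymmetricAbout (H j) D) (hk : iterSymmetral H C k ⊆ D) :
    iterSymmetral H C m ⊆ D := by
  induction m, hkm using Nat.le_induction with
  | base => exact hk
  | succ m hkm ih =>
    exact fiberSymmetral_subset hD (hsym m hkm m.lt_succ_self)
      (ih fun j hj hjm => hsym j hj (hjm.trans m.lt_succ_self))

/-- The iterated fiber symmetrals of a nonempty compact set, as nonempty compact sets. -/
noncomputable def iterCompacts (H : ℕ → Submodule ℝ (E n)) (hC : IsCompact C) (hne : C.Nonempty)
    (m : ℕ) : NonemptyCompacts (E n) :=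
  ⟨⟨iterSymmetral H C m, isCompact_iterSymmetral hC m⟩, nonempty_iterSymmetral hne m⟩

theorem coe_iterCompacts (hC : IsCompact C) (hne : C.Nonempty) (m : ℕ) :
    (iterCompacts H hC hne m : Set (E n)) = iterSymmetral H C m := rfl

theorem energy_iterCompacts_succ_le (hC : IsCompact C) (hne : C.Nonempty) (m : ℕ) :
    energy (iterCompacts H hC hne (m + 1)) ≤ symmEnergy (H m) (iterCompacts H hC hne m) :=
  energy_le_symmEnergy rfl

theorem exists_tendsto_energy_iterCompacts (hC : IsCompact C) (hne : C.Nonempty) :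
    ∃ c, Tendsto (fun m => energy (iterCompacts H hC hne m)) atTop (𝓝 c) := by
  have hanti : Antitone fun m => energy (iterCompacts H hC hne m) :=
    antitone_nat_of_succ_le fun m =>
      (energy_iterCompacts_succ_le hC hne m).trans (symmEnergy_le_energy _ _)
  refine ⟨_, tendsto_atTop_ciInf hanti ⟨0, ?_⟩⟩
  rintro _ ⟨m, rfl⟩
  exact energy_nonneg _

/-- A subsequential limit of the iterated fiber symmetrals of a convex body with respect to a finite
family of subspaces is symmetric about all but finitely many terms of the sequence of subspaces. -/
theorem eventually_isSymmetricAbout (hC : IsCompact C) (hne : C.Nonempty) (hconv : Convex ℝ C)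
    (hfin : (Set.range H).Finite) {L : NonemptyCompacts (E n)} {φ : ℕ → ℕ} (hφ : StrictMono φ)
    (hlim : Tendsto (fun k => iterCompacts H hC hne (φ k)) atTop (𝓝 L)) :
    ∀ᶠ m in atTop, IsSymmetricAbout (H m) (L : Set (E n)) := by
  classical
  by_contra hcon
  have hL : Convex ℝ (L : Set (E n)) := convex_of_tendsto hlim fun k => convex_iterSymmetral hconv _
  have hex : ∀ k, ∃ m, φ k ≤ m ∧ ¬ IsSymmetricAbout (H m) (L : Set (E n)) :=
    fun k => (frequently_atTop.1 (not_eventually.1 hcon)) (φ k)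
  -- `N k` is the first time from `φ k` on at which the subspace fails to be a symmetry of `L`;
  -- until then the iterates stay near `L`.
  let N : ℕ → ℕ := fun k => Nat.find (hex k)
  have hφN : ∀ k, φ k ≤ N k := fun k => (Nat.find_spec (hex k)).1
  have hNsym : ∀ k, ¬ IsSymmetricAbout (H (N k)) (L : Set (E n)) :=
    fun k => (Nat.find_spec (hex k)).2
  have hbefore : ∀ k j, φ k ≤ j → j < N k → IsSymmetricAbout (H j) (L : Set (E n)) := by
    intro k j hj hjN
    by_contra h
    exact Nat.find_min (hex k) hjN ⟨hj, h⟩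
  have hN : Tendsto N atTop atTop := tendsto_atTop_mono hφN hφ.tendsto_atTop
  obtain ⟨c, hc⟩ := exists_tendsto_energy_iterCompacts (H := H) hC hne
  have hcL : energy L = c :=
    tendsto_nhds_unique ((continuous_energy.tendsto L).comp hlim) (hc.comp hφ.tendsto_atTop)
  obtain ⟨r, hr⟩ := hC.isBounded.subset_closedBall (0 : E n)
  have hNlim : Tendsto (fun k => iterCompacts H hC hne (N k)) atTop (𝓝 L) := by
    refine tendsto_of_energy_tendsto (r := r) (fun k => iterSymmetral_subset_closedBall hr _)
      (fun k => convex_iterSymmetral hconv _) (fun ε hε => ?_) (hcL ▸ hc.comp hN)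
    filter_upwards [eventually_subset_cthickening hlim hε] with k hk
    exact iterSymmetral_subset_of_le (hL.cthickening ε) (hφN k)
      (fun j hj hjN => (hbefore k j hj hjN).cthickening ε) hk
  -- Pigeonhole on the finite family: one bad subspace recurs at infinitely many `k`.
  obtain ⟨Q, hQ⟩ : ∃ Q, ∃ᶠ k in atTop, H (N k) = Q := by
    by_contra! h
    have h' : ∀ᶠ k in (atTop : Filter ℕ), ∀ Q ∈ Set.range H, H (N k) ≠ Q :=
      (eventually_all_finite hfin).2 fun Q _ => h Q
    obtain ⟨k, hk⟩ := h'.exists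
    exact hk _ ⟨_, rfl⟩ rfl
  -- The energies one step after `N k` also tend to `c`, so in the limit symmetrizing `L` about `Q`
  -- loses no energy, which forces symmetry.
  have hle : c ≤ symmEnergy Q L := by
    refine le_of_tendsto_of_tendsto_of_frequently
      (hc.comp ((tendsto_add_atTop_nat 1).comp hN))
      (((continuous_symmEnergy Q).tendsto L).comp hNlim) (hQ.mono fun k hk => ?_)
    subst hk
    exact energy_iterCompacts_succ_le hC hne (N k)
  obtain ⟨k, rfl⟩ := hQ.exists
  exact hNsym k (isSymmetricAbout_of_symmEnergy_eq hL
    (le_antisymm (symmEnergy_le_energy _ _) (hcL ▸ hle)))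

theorem exists_tendsto_iterCompacts (hC : IsCompact C) (hne : C.Nonempty) (hconv : Convex ℝ C)
    (hfin : (Set.range H).Finite) :
    ∃ L : NonemptyCompacts (E n), Convex ℝ (L : Set (E n)) ∧
      Tendsto (iterCompacts H hC hne) atTop (𝓝 L) ∧
      ∀ᶠ m in atTop, IsSymmetricAbout (H m) (L : Set (E n)) := by
  obtain ⟨r, hr⟩ := hC.isBounded.subset_closedBall (0 : E n)
  obtain ⟨L, -, φ, hφ, hlim⟩ :=
    (NonemptyCompacts.isCompact_subsets_of_isCompact (isCompact_closedBall (0 : E n) r)).tendsto_subseq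
      (x := iterCompacts H hC hne) fun k => iterSymmetral_subset_closedBall hr k
  have hL : Convex ℝ (L : Set (E n)) := convex_of_tendsto hlim fun k => convex_iterSymmetral hconv _
  have hsym := eventually_isSymmetricAbout hC hne hconv hfin hφ hlim
  obtain ⟨c, hc⟩ := exists_tendsto_energy_iterCompacts (H := H) hC hne
  have hcL : energy L = c :=
    tendsto_nhds_unique ((continuous_energy.tendsto L).comp hlim) (hc.comp hφ.tendsto_atTop)
  refine ⟨L, hL, tendsto_of_energy_tendsto (r := r)
    (fun k => iterSymmetral_subset_closedBall hr _) (fun k => convex_iterSymmetral hconv _)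
    (fun ε hε => ?_) (hcL ▸ hc), hsym⟩
  obtain ⟨m₀, hm₀⟩ := eventually_atTop.1 hsym
  obtain ⟨k, hk, hkm⟩ := ((eventually_subset_cthickening hlim hε).and
    (hφ.tendsto_atTop.eventually_ge_atTop m₀)).exists
  filter_upwards [eventually_ge_atTop (φ k)] with m hm
  exact iterSymmetral_subset_of_le (hL.cthickening ε) hm
    (fun j hj _ => (hm₀ j (hkm.trans hj)).cthickening ε) hk

theorem hausdorffTendsto_iff {A : ℕ → NonemptyCompacts (E n)} {L : NonemptyCompacts (E n)} :
    HausdorffTendsto (fun m => (A m : Set (E n))) L ↔ Tendsto A atTop (𝓝 L) := by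
  rw [tendsto_iff_edist_tendsto_0]
  rfl

/-- The sequences agree from index one on; at index zero they are `K` and its hull. -/
theorem iterSymmetral_convexHull_succ {K : Set (E n)} (hK : IsCompact K)
    (hbd : frontier (convexHull ℝ K) ⊆ K) (hH : Module.finrank ℝ (H 0) + 2 ≤ n) (m : ℕ) :
    iterSymmetral H (convexHull ℝ K) (m + 1) = iterSymmetral H K (m + 1) := by
  induction m with
  | zero => exact fiberSymmetral_convexHull hH hK hbd
  | succ m ih => exact congrArg (fiberSymmetral (H (m + 1))) ih

end Iterates

end FiberSymm

theorem theorem3 (n : ℕ) (K : Set (FiberSymm.E n)) (hne : K.Nonempty) (hK : IsCompact K)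
    (hbd : frontier (convexHull ℝ K) ⊆ K)
    (F : Finset (Submodule ℝ (FiberSymm.E n)))
    (hF : ∀ Q ∈ F, 1 ≤ Module.finrank ℝ Q ∧ Module.finrank ℝ Q + 2 ≤ n)
    (H : ℕ → Submodule ℝ (FiberSymm.E n)) (hH : ∀ m, H m ∈ F) :
    ∃ L : Set (FiberSymm.E n), L.Nonempty ∧ IsCompact L ∧ Convex ℝ L ∧
      FiberSymm.HausdorffTendsto (FiberSymm.iterSymmetral H K) L ∧
      FiberSymm.HausdorffTendsto (FiberSymm.iterSymmetral H (convexHull ℝ K)) L ∧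
      ∀ Q ∈ F, {m : ℕ | H m = Q}.Infinite → FiberSymm.IsSymmetricAbout Q L := by
  obtain ⟨L, hL, hlim, hsym⟩ := FiberSymm.exists_tendsto_iterCompacts (H := H)
    (FiberSymm.isCompact_convexHull_of_frontier_subset hK hbd) hne.convexHull
    (convex_convexHull ℝ K) (F.finite_toSet.subset (Set.range_subset_iff.2 hH))
  have hlim' := FiberSymm.hausdorffTendsto_iff.2 hlim
  refine ⟨L, L.nonempty, L.isCompact, hL, ?_, hlim', fun Q _ hQ => ?_⟩
  · refine Filter.Tendsto.congr' ?_ hlim'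
    filter_upwards [Filter.eventually_ge_atTop 1] with m hm
    obtain ⟨m, rfl⟩ := Nat.exists_eq_add_of_le' hm
    rw [FiberSymm.coe_iterCompacts,
      FiberSymm.iterSymmetral_convexHull_succ hK hbd (hF _ (hH 0)).2]
  -- A subspace occurring infinitely often occurs at an index past which every `H m` is a symmetry
  -- of `L`.
  · obtain ⟨m, rfl, hm⟩ := ((Nat.frequently_atTop_iff_infinite.2 hQ).and_eventually hsym).exists
    exact hm
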